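/- **Theorem.** Let $D$ be a principal ideal domain and let $A$ be a square matrix over the polynomial ring $D[x]$ that is not nilpotent. Let $l$ be the least integer $k\ge 1$ with $\operatorname{rank}(A^k)=\operatorname{rank}(A^{k+1})$ (such $k$ exists). Then $A$ is algebraically strong shift equivalent of lag $l$ over $D[x]$ to a nonsingular matrix $B$, that is, there are square matrices $A=A_0,A_1,\dots,A_l=B$ over $D[x]$, of possibly different positive orders, with $\det B\neq 0$, and matrices $U_i,V_i$ over $D[x]$ such that $A_{i-1}=U_iV_i$ and $V_iU_i=A_i$ for $i=1,\dots,l$. In particular $D[x]$ has property NSSEN: every non-nilpotent square matrix over $D[x]$ is algebraically strong shift equivalent (of lag $l$ for some integer $l\ge1$) to some nonsingular matrix. -/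

import Mathlib

open Polynomial

/-- Two square matrices `A` and `B`, of possibly different (positive) orders, over a semiring are
elementarily strong shift equivalent if `A = U V` and `V U = B` for some matrices `U`, `V`. -/
def ElemStrongShiftEquiv {R : Type*} [Semiring R] {n m : ℕ}
    (A : Matrix (Fin n) (Fin n) R) (B : Matrix (Fin m) (Fin m) R) : Prop :=
  0 < n ∧ 0 < m ∧
    ∃ (U : Matrix (Fin n) (Fin m) R) (V : Matrix (Fin m) (Fin n) R), A = U * V ∧ V * U = B

/-- `StrongShiftEquivLag l A B`: there is a sequence of `l` elementary strong shift equivalences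
`A = A₀ ≡ A₁`, `A₁ ≡ A₂`, …, `Aₗ₋₁ ≡ Aₗ = B`. -/
inductive StrongShiftEquivLag {R : Type*} [Semiring R] :
    ℕ → ∀ {n m : ℕ}, Matrix (Fin n) (Fin n) R → Matrix (Fin m) (Fin m) R → Prop
  | refl {n : ℕ} (A : Matrix (Fin n) (Fin n) R) : StrongShiftEquivLag 0 A A
  | step {l n m k : ℕ} {A : Matrix (Fin n) (Fin n) R} {B : Matrix (Fin m) (Fin m) R}
      {C : Matrix (Fin k) (Fin k) R} :
      ElemStrongShiftEquiv A B → StrongShiftEquivLag l B C → StrongShiftEquivLag (l + 1) A C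

/-- Algebraic strong shift equivalence: of lag `l` for some positive integer `l`. -/
def StrongShiftEquiv {R : Type*} [Semiring R] {n m : ℕ}
    (A : Matrix (Fin n) (Fin n) R) (B : Matrix (Fin m) (Fin m) R) : Prop :=
  ∃ l : ℕ, 0 < l ∧ StrongShiftEquivLag l A B

/-- Property NSSEN of a domain: every non-nilpotent square matrix over it is algebraically strong
shift equivalent to some nonsingular matrix (one with nonzero determinant). -/
def HasNSSEN (R : Type*) [CommRing R] [IsDomain R] : Prop :=
  ∀ (n : ℕ) (A : Matrix (Fin n) (Fin n) R), ¬ IsNilpotent A →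
    ∃ (m : ℕ) (B : Matrix (Fin m) (Fin m) R), B.det ≠ 0 ∧ StrongShiftEquiv A B

/-! Factor `A = U * V` with inner dimension `A.rank`. Then `(V * U) ^ k` has the rank of `A ^ (k +
1)`, so passing to `V * U` lowers the stabilization index by one; at index one `V * U` has full
rank. The factorization exists over `K[x]`, with `K` the fraction field of `D`, hence over `D[x]` up
to a constant `d`. Prime factors `p` of `d` are cancelled one at a time, using that `(D/p)[x]` is
Euclidean. -/

/-- A product of matrices divisible by the generator `p` of the kernel of a surjection onto a
Euclidean domain is `p` times a product with the same inner dimension. -/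
theorem exists_mul_eq_smul_mul_of_dvd {R E m n : Type*} [CommRing R] [EuclideanDomain E]
    (f : R →+* E) (hf : Function.Surjective f) {p : R} (hp : ∀ a, f a = 0 ↔ p ∣ a) {r : ℕ}
    (U : Matrix m (Fin r) R) (V : Matrix (Fin r) n R) (h : ∀ i j, p ∣ (U * V) i j) :
    ∃ (U' : Matrix m (Fin r) R) (V' : Matrix (Fin r) n R), U * V = p • (U' * V') := by
  induction r with
  | zero => exact ⟨U, V, by ext; simp [Matrix.mul_apply]⟩
  | succ r ih =>
    by_cases hU : ∀ i j, p ∣ U i j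
    · choose W hW using hU
      refine ⟨Matrix.of W, V, ?_⟩
      rw [← Matrix.smul_mul]
      congr 1
      ext i j
      simp [hW]
    push Not at hU
    obtain ⟨i₀, j₀, h₀⟩ := hU
    -- Nonzero residues of left-factor entries, over all factorizations of `U * V` with this inner
    -- dimension; a Euclidean-minimal one serves as pivot.
    let s : Set E := {e | e ≠ 0 ∧ ∃ (U' : Matrix m (Fin (r + 1)) R)
      (V' : Matrix (Fin (r + 1)) n R) (i : m) (j : Fin (r + 1)), U' * V' = U * V ∧ f (U' i j) = e}
    have hs : s.Nonempty := ⟨f (U i₀ j₀), by rwa [Ne, hp], U, V, i₀, j₀, rfl, rfl⟩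
    obtain ⟨e, ⟨he, U₀, V₀, i, j, hUV, rfl⟩, hmin⟩ :=
      EuclideanDomain.r_wellFounded.has_min s hs
    choose g hg using hf
    let q : Fin (r + 1) → R := fun b => if b = j then 0 else g (f (U₀ i b) / f (U₀ i j))
    -- `1 - N` is the column operation reducing row `i` modulo the pivot; `N * N = 0` makes `1 + N`
    -- its inverse.
    let N : Matrix (Fin (r + 1)) (Fin (r + 1)) R := Matrix.vecMulVec (Pi.single j 1) q
    have hN : N * N = 0 := by
      ext a b
      simp [N, q, Matrix.mul_apply, Matrix.vecMulVec_apply, Pi.single_apply]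
    have hUV₁ : (U₀ * (1 - N)) * ((1 + N) * V₀) = U * V := by
      have h1 : (1 - N) * (1 + N) = 1 := by
        rw [sub_mul, mul_add, mul_add, hN]
        simp
      rw [Matrix.mul_assoc, ← Matrix.mul_assoc (1 - N), h1, Matrix.one_mul, hUV]
    have hU₁ : ∀ a b, (U₀ * (1 - N) : Matrix m (Fin (r + 1)) R) a b = U₀ a b - U₀ a j * q b := by
      intro a b
      rw [Matrix.mul_sub, Matrix.mul_one, Matrix.sub_apply, Matrix.mul_apply]
      simp [N, Matrix.vecMulVec_apply, Pi.single_apply]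
    generalize U₀ * (1 - N) = U₁ at hUV₁ hU₁
    generalize (1 + N) * V₀ = V₁ at hUV₁
    have hj : U₁ i j = U₀ i j := by simp [hU₁, q]
    have hb : ∀ b, b ≠ j → f (U₁ i b) = 0 := by
      intro b hbj
      by_contra hne
      refine hmin _ ⟨hne, U₁, V₁, i, b, hUV₁, rfl⟩ ?_
      have : f (U₁ i b) = f (U₀ i b) % f (U₀ i j) := by
        rw [EuclideanDomain.mod_eq_sub_mul_div, hU₁]
        simp [q, hbj, hg]
      rw [this]
      exact EuclideanDomain.mod_lt _ he
    -- Modulo `p`, row `i` of `U₁` has only the pivot left, so it alone multiplies row `j` of `V₁`.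
    have hV : ∀ c, p ∣ V₁ j c := by
      intro c
      have h1 := (hp _).2 (h i c)
      rw [← hUV₁, Matrix.mul_apply, map_sum, Finset.sum_eq_single j] at h1
      · rw [map_mul, hj] at h1
        exact (hp _).1 ((mul_eq_zero.1 h1).resolve_left he)
      · intro b _ hbj
        rw [map_mul, hb b hbj, zero_mul]
      · simp
    choose w hw using hV
    have hsplit : ∀ a c, (U * V) a c = U₁ a j * V₁ j c +
        (U₁.submatrix id j.succAbove * V₁.submatrix j.succAbove id) a c := by
      intro a c
      rw [← hUV₁, Matrix.mul_apply, Fin.sum_univ_succAbove _ j]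
      rfl
    obtain ⟨U₂, V₂, h₂⟩ := ih (U₁.submatrix id j.succAbove) (V₁.submatrix j.succAbove id) (by
      intro a c
      have h1 := h a c
      rw [hsplit, hw] at h1
      exact (dvd_add_right (Dvd.intro _ (by ring : p * (U₁ a j * w c) = _))).1 h1)
    refine ⟨Matrix.of fun a => Fin.cons (U₁ a j) (U₂ a), Matrix.of (Fin.cons w V₂), ?_⟩
    ext a c
    rw [hsplit, h₂, hw, Matrix.smul_apply, Matrix.smul_apply, Matrix.mul_apply, Matrix.mul_apply,
      Fin.sum_univ_succ]
    change U₁ a j * (p * w c) + p * (U₂ * V₂) a c = p * (U₁ a j * w c + (U₂ * V₂) a c)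
    ring

/-- Over `D[x]` with `D` a principal ideal domain, a nonzero constant can be cancelled from a
matrix factorization without changing the inner dimension. -/
theorem exists_eq_mul_of_C_smul_eq_mul {D m n : Type*} [CommRing D] [IsDomain D]
    [IsPrincipalIdealRing D] {r : ℕ} (A : Matrix m n D[X]) {d : D} (hd : d ≠ 0)
    (U : Matrix m (Fin r) D[X]) (V : Matrix (Fin r) n D[X]) (h : C d • A = U * V) :
    ∃ (U' : Matrix m (Fin r) D[X]) (V' : Matrix (Fin r) n D[X]), A = U' * V' := by
  induction d using WfDvdMonoid.induction_on_irreducible generalizing U V with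
  | zero => exact absurd rfl hd
  | unit u hu =>
    obtain ⟨v, hv⟩ := hu.exists_left_inv
    refine ⟨C v • U, V, ?_⟩
    rw [Matrix.smul_mul, ← h, smul_smul, ← C_mul, hv, C_1, one_smul]
  | mul a p ha hp ih =>
    have hmax : (Ideal.span {p}).IsMaximal :=
      PrincipalIdealRing.isMaximal_of_irreducible hp
    let : Field (D ⧸ Ideal.span {p}) := Ideal.Quotient.field _
    obtain ⟨U', V', hUV⟩ := exists_mul_eq_smul_mul_of_dvd (p := C p)
      (mapRingHom (Ideal.Quotient.mk (Ideal.span {p})))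
      (map_surjective _ Ideal.Quotient.mk_surjective)
      (fun f => by
        rw [C_dvd_iff_dvd_coeff, Polynomial.ext_iff]
        simp [Ideal.Quotient.eq_zero_iff_mem, Ideal.mem_span_singleton]) U V
      (fun i j => by
        rw [← h, C_mul]
        exact ⟨C a * A i j, by simp [mul_assoc]⟩)
    refine ih ha U' V' ?_
    rw [← h, C_mul, mul_smul] at hUV
    ext1 i j
    exact mul_left_cancel₀ (C_ne_zero.2 hp.ne_zero) (congrFun (congrFun hUV i) j)

/-- If a localization of a domain is a principal ideal domain, then a matrix has a rank
factorization up to a denominator. -/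
theorem Matrix.exists_smul_eq_mul_of_isLocalization {R S : Type*} [CommRing R] [IsDomain R]
    [CommRing S] [IsDomain S] [IsPrincipalIdealRing S] [Algebra R S] (M : Submonoid R)
    (hM : M ≤ nonZeroDivisors R) [IsLocalization M S] {m n : ℕ}
    (A : Matrix (Fin m) (Fin n) R) :
    ∃ d ∈ M, ∃ (U : Matrix (Fin m) (Fin A.rank) R) (V : Matrix (Fin A.rank) (Fin n) R),
      d • A = U * V := by
  let f : (Fin m → R) →ₗ[R] (Fin m → S) := LinearMap.pi fun i =>
    (Algebra.linearMap R S).comp (LinearMap.proj i)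
  have : IsLocalizedModule M f := inferInstance
  let N := Submodule.localized' S M f (LinearMap.range A.mulVecLin)
  have hrank : Module.finrank S N = A.rank := by
    rw [IsLocalization.finrank_eq S M hM]
    exact IsLocalizedModule.finrank_eq M
      (Submodule.toLocalized' S M f (LinearMap.range A.mulVecLin)) hM
  -- The localized column space is free over the PID `S`: basis vectors give `U`, coordinates of the
  -- columns give `V`.
  let b := Module.finBasisOfFinrankEq S N hrank
  have hmem : ∀ j, f (A.col j) ∈ N := fun j =>
    ⟨A.col j, ⟨Pi.single j 1, by simp⟩, 1, by simp⟩
  obtain ⟨c, hc⟩ := IsLocalization.exist_integer_multiples_of_finite M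
    fun ij : Fin m × Fin A.rank => (b ij.2 : Fin m → S) ij.1
  obtain ⟨d, hd⟩ := IsLocalization.exist_integer_multiples_of_finite M
    fun ij : Fin A.rank × Fin n => b.repr ⟨f (A.col ij.2), hmem ij.2⟩ ij.1
  choose U hU using hc
  choose V hV using hd
  refine ⟨c * d, M.mul_mem c.2 d.2, Matrix.of fun i j => U (i, j), Matrix.of fun i j => V (i, j), ?_⟩
  ext i j
  apply IsLocalization.injective S hM
  have hsum := congrArg (fun x : N => (x : Fin m → S) i) (b.sum_repr ⟨f (A.col j), hmem j⟩)
  simp only [AddSubmonoidClass.coe_finsetSum, Finset.sum_apply, SetLike.val_smul,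
    Pi.smul_apply] at hsum
  simp only [Matrix.smul_apply, Matrix.mul_apply, map_sum, map_mul, Matrix.of_apply, hU, hV,
    smul_eq_mul, Algebra.smul_def]
  have hfA : f (A.col j) i = algebraMap R S (A i j) := rfl
  rw [← hfA, ← hsum, Finset.mul_sum]
  refine Finset.sum_congr rfl fun k _ => ?_
  simp only [smul_eq_mul]
  ring

/-- Every matrix over `D[x]`, `D` a principal ideal domain, has a rank factorization. -/
theorem Matrix.exists_rank_factorization {D : Type*} [CommRing D] [IsDomain D]
    [IsPrincipalIdealRing D] {m n : ℕ} (A : Matrix (Fin m) (Fin n) D[X]) :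
    ∃ (U : Matrix (Fin m) (Fin A.rank) D[X]) (V : Matrix (Fin A.rank) (Fin n) D[X]),
      A = U * V := by
  let : Algebra D[X] (FractionRing D)[X] := (mapRingHom (algebraMap D (FractionRing D))).toAlgebra
  have : IsLocalization ((nonZeroDivisors D).map C) (FractionRing D)[X] :=
    Polynomial.isLocalization _ _
  obtain ⟨_, ⟨d, hd, rfl⟩, U, V, h⟩ := A.exists_smul_eq_mul_of_isLocalization
    (S := (FractionRing D)[X]) ((nonZeroDivisors D).map C) (by
      rintro _ ⟨d, hd, rfl⟩
      exact mem_nonZeroDivisors_of_ne_zero (C_ne_zero.2 (nonZeroDivisors.ne_zero hd)))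
  exact exists_eq_mul_of_C_smul_eq_mul A (nonZeroDivisors.ne_zero hd) U V h

theorem Matrix.mulVec_injective_of_rank_eq_width {R : Type*} [CommRing R] [IsDomain R] {m r : ℕ}
    (U : Matrix (Fin m) (Fin r) R) (h : U.rank = r) : Function.Injective U.mulVecLin := by
  have h' : Module.finrank R (LinearMap.range U.mulVecLin) = r := h
  have hsum := LinearMap.rank_range_add_rank_ker U.mulVecLin
  rw [← Module.finrank_eq_rank, h', rank_fun', Fintype.card_fin] at hsum
  rw [← LinearMap.ker_eq_bot, ← Submodule.rank_eq_zero (R := R)]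
  exact Cardinal.eq_of_add_eq_add_left (hsum.trans (add_zero _).symm) Cardinal.natCast_lt_aleph0

theorem Matrix.det_ne_zero_of_rank_eq {R : Type*} [CommRing R] [IsDomain R] {r : ℕ}
    (B : Matrix (Fin r) (Fin r) R) (h : B.rank = r) : B.det ≠ 0 := by
  intro hdet
  obtain ⟨v, hv, hBv⟩ := Matrix.exists_mulVec_eq_zero_iff.2 hdet
  exact hv (B.mulVec_injective_of_rank_eq_width h (by simpa using hBv))

theorem Matrix.rank_mul_eq_right_of_rank_eq_width {R : Type*} [CommRing R] [IsDomain R]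
    {m r n : ℕ} (U : Matrix (Fin m) (Fin r) R) (h : U.rank = r) (X : Matrix (Fin r) (Fin n) R) :
    (U * X).rank = X.rank := by
  unfold Matrix.rank
  rw [Matrix.mulVecLin_mul, LinearMap.range_comp]
  exact (Submodule.equivMapOfInjective _ (U.mulVec_injective_of_rank_eq_width h) _).finrank_eq.symm

/-- Some `W` makes `V * W` square and nonsingular, so multiplying `X * V` by `W` recovers the rank
of `X`. -/
theorem Matrix.rank_mul_eq_left_of_rank_eq_height {R : Type*} [CommRing R] [IsDomain R]
    {m r n : ℕ} (V : Matrix (Fin r) (Fin n) R) (h : V.rank = r) (X : Matrix (Fin m) (Fin r) R) :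
    (X * V).rank = X.rank := by
  obtain ⟨v, hv⟩ := exists_linearIndependent_of_le_finrank
    (R := R) (M := LinearMap.range V.mulVecLin) h.ge
  choose w hw using fun i => (v i).2
  let W : Matrix (Fin n) (Fin r) R := Matrix.of fun i j => w j i
  have hli : LinearIndependent R fun i => (v i : Fin r → R) :=
    hv.map' (Submodule.subtype _) (Submodule.ker_subtype _)
  have hcol : (V * W).col = fun i => (v i : Fin r → R) := by
    funext j
    rw [← hw j]
    rfl
  have hdet : (V * W).det ≠ 0 := by
    intro hdet
    obtain ⟨x, hx, hx0⟩ := Matrix.exists_mulVec_eq_zero_iff.2 hdet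
    rw [← hcol] at hli
    exact hx (Matrix.mulVec_injective_iff.2 hli (by simpa using hx0))
  refine le_antisymm (Matrix.rank_mul_le_left _ _) ?_
  rw [← Matrix.rank_mul_eq_left_of_det_ne_zero (V * W) X hdet, ← Matrix.mul_assoc]
  exact Matrix.rank_mul_le_left _ _

theorem Matrix.rank_mul_mul_of_rank_eq {R : Type*} [CommRing R] [IsDomain R] {n m r : ℕ}
    (U : Matrix (Fin n) (Fin r) R) (V : Matrix (Fin r) (Fin m) R) (h : (U * V).rank = r)
    (X : Matrix (Fin r) (Fin r) R) : (U * X * V).rank = X.rank := by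
  rw [Matrix.rank_mul_eq_left_of_rank_eq_height, Matrix.rank_mul_eq_right_of_rank_eq_width]
  · exact le_antisymm U.rank_le_width (h.ge.trans (Matrix.rank_mul_le_left _ _))
  · exact le_antisymm V.rank_le_height (h.ge.trans (Matrix.rank_mul_le_right _ _))

theorem Matrix.mul_pow_succ_eq_mul_pow_mul {R : Type*} [CommRing R] {n r : ℕ}
    (U : Matrix (Fin n) (Fin r) R) (V : Matrix (Fin r) (Fin n) R) (k : ℕ) :
    (U * V) ^ (k + 1) = U * (V * U) ^ k * V := by
  induction k with
  | zero => simp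
  | succ k ih => rw [pow_succ, ih, pow_succ]; simp only [Matrix.mul_assoc]

theorem exists_strongShiftEquivLag_of_isLeast {D : Type*} [CommRing D] [IsDomain D]
    [IsPrincipalIdealRing D] {l n : ℕ} (A : Matrix (Fin n) (Fin n) D[X]) (hA : ¬ IsNilpotent A)
    (hl : IsLeast {k : ℕ | 0 < k ∧ (A ^ k).rank = (A ^ (k + 1)).rank} l) :
    ∃ (m : ℕ) (B : Matrix (Fin m) (Fin m) D[X]), B.det ≠ 0 ∧ StrongShiftEquivLag l A B := by
  induction l generalizing n with
  | zero => exact absurd hl.1.1 (lt_irrefl _)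
  | succ l ih =>
    obtain ⟨U, V, hUV⟩ := A.exists_rank_factorization
    have hn : 0 < n := by
      rcases Nat.eq_zero_or_pos n with rfl | h
      · exact absurd ⟨1, Subsingleton.elim _ _⟩ hA
      · exact h
    -- An empty inner dimension would force `A = 0`, which is nilpotent.
    have hr : 0 < A.rank := by
      by_contra h
      have : IsEmpty (Fin A.rank) := by
        rw [Nat.eq_zero_of_not_pos h]
        infer_instance
      exact hA ⟨1, by rw [pow_one, hUV]; ext; simp [Matrix.mul_apply]⟩
    have hpow : ∀ k, A ^ (k + 1) = U * (V * U) ^ k * V := fun k => by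
      rw [← Matrix.mul_pow_succ_eq_mul_pow_mul, ← hUV]
    have hrank : ∀ k, ((V * U) ^ k).rank = (A ^ (k + 1)).rank := fun k => by
      rw [hpow, Matrix.rank_mul_mul_of_rank_eq U V (by rw [← hUV])]
    have hstep : ElemStrongShiftEquiv A (V * U) := ⟨hn, hr, U, V, hUV, rfl⟩
    rcases Nat.eq_zero_or_pos l with rfl | hl0
    -- Here `V * U` has order `A.rank` and rank `(A ^ 2).rank = A.rank`.
    · refine ⟨_, V * U, Matrix.det_ne_zero_of_rank_eq _ ?_, .step hstep (.refl _)⟩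
      have h1 := hl.1.2
      rw [zero_add, pow_one] at h1
      rw [← pow_one (V * U), hrank]
      exact h1.symm
    · obtain ⟨m, B, hB, hAB⟩ := ih (V * U)
        (fun ⟨k, hk⟩ => hA ⟨k + 1, by rw [hpow, hk, Matrix.mul_zero, Matrix.zero_mul]⟩)
        ⟨⟨hl0, by rw [hrank, hrank]; exact hl.1.2⟩, fun k hk => by
          have h1 := hk.2
          rw [hrank, hrank] at h1
          exact Nat.le_of_succ_le_succ (hl.2 ⟨Nat.succ_pos k, h1⟩)⟩
      exact ⟨m, B, hB, .step hstep hAB⟩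

theorem Matrix.exists_isLeast_rank_pow_eq {R : Type*} [CommRing R] [Nontrivial R] {n : ℕ}
    (A : Matrix (Fin n) (Fin n) R) :
    ∃ l, IsLeast {k : ℕ | 0 < k ∧ (A ^ k).rank = (A ^ (k + 1)).rank} l := by
  suffices h : {k : ℕ | 0 < k ∧ (A ^ k).rank = (A ^ (k + 1)).rank}.Nonempty from
    ⟨_, Nat.sInf_mem h, fun _ hk => Nat.sInf_le hk⟩
  by_contra hne
  rw [Set.not_nonempty_iff_eq_empty] at hne
  have hlt : ∀ k, (A ^ (k + 1 + 1)).rank < (A ^ (k + 1)).rank := fun k =>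
    lt_of_le_of_ne (by rw [pow_succ A (k + 1)]; exact Matrix.rank_mul_le_left _ _)
      fun h => hne.le (⟨Nat.succ_pos k, h.symm⟩ :
        k + 1 ∈ {k : ℕ | 0 < k ∧ (A ^ k).rank = (A ^ (k + 1)).rank})
  have hanti : StrictAnti fun k => (A ^ (k + 1)).rank := strictAnti_nat_of_succ_lt hlt
  exact not_strictAnti_of_wellFoundedLT _ hanti

theorem theorem1 {D : Type*} [CommRing D] [IsDomain D] [IsPrincipalIdealRing D] :
    (∀ (n : ℕ) (A : Matrix (Fin n) (Fin n) D[X]), ¬ IsNilpotent A →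
      ∃ l : ℕ, IsLeast {k : ℕ | 0 < k ∧ (A ^ k).rank = (A ^ (k + 1)).rank} l ∧
        ∃ (m : ℕ) (B : Matrix (Fin m) (Fin m) D[X]),
          B.det ≠ 0 ∧ StrongShiftEquivLag l A B) ∧
    HasNSSEN D[X] := by
  refine ⟨fun n A hA => ?_, fun n A hA => ?_⟩ <;>
    obtain ⟨l, hl⟩ := A.exists_isLeast_rank_pow_eq <;>
    obtain ⟨m, B, hB, hAB⟩ := exists_strongShiftEquivLag_of_isLeast A hA hl
  · exact ⟨l, hl, m, B, hB, hAB⟩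
  · exact ⟨m, B, hB, l, hl.1.1, hAB⟩
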